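/- Let $d\ge 1$, let $\mathbf n=(n_1,\dots,n_d)$ be a tuple of positive integers, let $\rho\in[d]=\{1,\dots,d\}$, and let $D\subseteq[d]^2$. Let $\mathcal T_\rho(\mathbf n)$ be the set of rooted trees (trees with one distinguished vertex, the root) with vertex set $\{(t,i): t\in[d],\ i\in[n_t]\}$ whose root is of the form $(\rho,i)$; the vertex $(t,i)$ is said to have type $t$. The edges of a rooted tree are oriented toward its root, and an edge has type $(s,t)$ if it goes from a vertex of type $s$ to a vertex of type $t$. A tree $T\in\mathcal T_\rho(\mathbf n)$ is embedded in $D$ if the type of every edge of $T$ belongs to $D$. Let $\mathrm{Cay}_d^\rho$ be the set of trees with vertex set $[d]$ rooted at the vertex $\rho$; for such a tree $A$, $(s,t)\in A$ means that the oriented edge from $s$ to $t$ belongs to $A$ (oriented toward $\rho$), and $A\subseteq D$ means that every oriented edge of $A$ belongs to $D$. Then the number of trees in $\mathcal T_\rho(\mathbf n)$ embedded in $D$ is $$\prod_{s\in[d]}\Bigg(\sum_{t:\,(s,t)\in D} n_t\Bigg)^{n_s-1}\times\ \sum_{\substack{A\in \mathrm{Cay}_d^\rho\\ A\subseteq D}}\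 \prod_{(s,t)\in A} n_t ,$$ where $0^0=1$. -/

import Mathlib

namespace MultitypeCayley

/-- A rooted (labelled) tree with vertex set `V`: a tree, that is, an acyclic connected simple
graph on `V`, with a distinguished root vertex. -/
@[ext]
structure RootedTree (V : Type*) where
  graph : SimpleGraph V
  isTree : graph.IsTree
  root : V

/-- `T.Arc u v`: the edge `{u, v}` of `T`, oriented toward the root, goes from `u` to `v`;
that is, `u` and `v` are adjacent and `v` is the endpoint closer to the root
(`v` is the parent of `u`). -/
def RootedTree.Arc {V : Type*} (T : RootedTree V) (u v : V) : Prop :=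
  T.graph.Adj u v ∧ T.graph.dist u T.root = T.graph.dist v T.root + 1

/-- There are finitely many rooted trees on a finite vertex set. -/
instance RootedTree.instFinite {V : Type*} [Finite V] : Finite (RootedTree V) :=
  Finite.of_injective (fun T : RootedTree V => (T.graph, T.root)) (by
    intro T T' h
    exact RootedTree.ext (congrArg Prod.fst h) (congrArg Prod.snd h))

noncomputable instance RootedTree.instFintype {V : Type*} [Finite V] : Fintype (RootedTree V) :=
  Fintype.ofFinite _

open Classical in
/-- The set of oriented edges of a rooted tree, oriented toward the root. -/
noncomputable def RootedTree.arcs {V : Type*} [Fintype V] (T : RootedTree V) : Finset (V × V) :=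
  Finset.univ.filter fun e => T.Arc e.1 e.2

/-- The vertex set `{(t, i) : t ∈ [d], i ∈ [n_t]}`; the vertex `(t, i)` has type `t` and
label `i`. -/
abbrev Vertex {d : ℕ} (n : Fin d → ℕ) : Type := Σ t : Fin d, Fin (n t)

open Classical in
/-- The rooted multitype Cayley trees of profile `n` whose root vertex has type `ρ`. -/
noncomputable def multitypeTrees {d : ℕ} (n : Fin d → ℕ) (ρ : Fin d) :
    Finset (RootedTree (Vertex n)) :=
  Finset.univ.filter fun T => T.root.1 = ρ

/-- A multitype Cayley tree is embedded in `D ⊆ [d]²` if the type `(s, t)` of each of its edges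
(going from a vertex of type `s` to a vertex of type `t`) belongs to `D`. -/
def IsEmbedded {d : ℕ} {n : Fin d → ℕ} (D : Finset (Fin d × Fin d))
    (T : RootedTree (Vertex n)) : Prop :=
  ∀ e ∈ T.arcs, (e.1.1, e.2.1) ∈ D

open Classical in
/-- The trees in `multitypeTrees n ρ` that are embedded in `D`. -/
noncomputable def embeddedTrees {d : ℕ} (n : Fin d → ℕ) (ρ : Fin d)
    (D : Finset (Fin d × Fin d)) : Finset (RootedTree (Vertex n)) :=
  (multitypeTrees n ρ).filter fun T => IsEmbedded D T

open Classical in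
/-- The (unitype) Cayley trees with vertex set `[d]` rooted at the vertex `ρ`. -/
noncomputable def cayleyTrees {d : ℕ} (ρ : Fin d) : Finset (RootedTree (Fin d)) :=
  Finset.univ.filter fun A => A.root = ρ

end MultitypeCayley

namespace MultitypeCayley

open Matrix Polynomial

/-! ### Determinants of Laplacians as sums over forests -/

section MatrixForest

variable {V R : Type*}

/-! Both sides are read off from determinants of Laplacians. Give the arc from `u` to `v` the weight
1 if its type lies in `D` and 0 otherwise, and mark roots of type `ρ` by a variable `X`, other roots
by 0. By the matrix-forest theorem the determinant enumerates parent maps without cycles, with `X`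
counting roots, so its coefficient of `X` counts the embedded trees
(`coeff_one_det_markedLaplacian`). This matrix depends only on types, apart from its diagonal: it is
a diagonal matrix minus one that factors through the `d` types. The identity `det (1 - P * Q) = det
(1 - Q * P)` turns its determinant into a product of powers of diagonal entries times the
determinant of a Laplacian on `[d]` with weights `n t` (`det_blowUpMatrix`). The latter has no
constant term, so the coefficient of `X` is the constant term of the product times the weighted
count of Cayley trees on `[d]`. -/

/-- A partial self-map, thought of as a parent map, is a forest when following parents always
terminates. -/
def IsForest (f : V → Option V) : Prop := WellFounded fun v u => f u = some v

variable [DecidableEq V] [CommRing R]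

/-- The row vector of a point, the point at infinity being sent to zero. -/
def optionSingle (R : Type*) [CommRing R] : Option V → V → R
  | none => 0
  | some v => Pi.single v 1

theorem optionSingle_apply (o : Option V) (v : V) :
    optionSingle R o v = if o = some v then 1 else 0 := by
  cases o with
  | none => simp [optionSingle]
  | some u => simp [optionSingle, Pi.single_apply, eq_comm]

/-- The matrix `1 - P`, where `P` is the transition matrix of the partial self-map `f`. -/
def parentMatrix (R : Type*) [CommRing R] (f : V → Option V) : Matrix V V R :=
  of fun u v => (if u = v then 1 else 0) - if f u = some v then 1 else 0

variable [Fintype V]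

theorem det_parentMatrix_of_isForest {f : V → Option V} (hf : IsForest f) :
    (parentMatrix R f).det = 1 := by
  classical
  have : IsWellFounded V (fun v u => f u = some v) := ⟨hf⟩
  -- A parent has smaller rank than its child; the order is dualized because `BlockTriangular` wants
  -- entries to vanish where `b v < b u`.
  let b : V → Ordinalᵒᵈ := fun u => OrderDual.toDual (IsWellFounded.rank (fun v u => f u = some v) u)
  have hlt : ∀ u v, f u = some v → b u < b v := fun u v h =>
    IsWellFounded.rank_lt_of_rel (r := fun v u => f u = some v) h
  have hb : BlockTriangular (parentMatrix R f) b := by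
    intro u v huv
    have h1 : u ≠ v := by rintro rfl; exact lt_irrefl _ huv
    have h2 : f u ≠ some v := fun h => lt_asymm huv (hlt u v h)
    simp [parentMatrix, h1, h2]
  rw [hb.det]
  refine Finset.prod_eq_one fun k _ => ?_
  have : (parentMatrix R f).toSquareBlock b k = 1 := by
    ext ⟨u, hu⟩ ⟨v, hv⟩
    have h2 : f u ≠ some v := fun h => (hlt u v h).ne (hu.trans hv.symm)
    simp [toSquareBlock_def, parentMatrix, h2, Matrix.one_apply]
  rw [this, det_one]

theorem det_parentMatrix_of_not_isForest [IsDomain R] {f : V → Option V} (hf : ¬ IsForest f) :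
    (parentMatrix R f).det = 0 := by
  classical
  rw [← exists_mulVec_eq_zero_iff]
  have hacc : ∀ u, Acc (fun v u => f u = some v) u ↔
      ∀ v, f u = some v → Acc (fun v u => f u = some v) v :=
    fun u => ⟨fun h v hv => h.inv hv, fun h => ⟨u, h⟩⟩
  -- The kernel vector is the indicator of the points from which following parents never ends: a
  -- point and its parent are alike in this respect.
  refine ⟨fun u => if Acc (fun v u => f u = some v) u then 0 else 1, ?_, ?_⟩
  · intro h
    refine hf ⟨fun u => ?_⟩
    by_contra hu
    simpa [hu] using congrFun h u
  · ext u
    have h := hacc u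
    cases hfu : f u with
    | none =>
      simp only [hfu, reduceCtorEq, false_implies, implies_true, iff_true] at h
      simp only [mulVec, dotProduct, parentMatrix, of_apply, hfu, reduceCtorEq, if_false, sub_zero,
        ite_mul, one_mul, zero_mul, Finset.sum_ite_eq, Finset.mem_univ, if_true, h, Pi.zero_apply]
    | some w =>
      simp only [hfu, Option.some.injEq, forall_eq'] at h
      simp only [mulVec, dotProduct, parentMatrix, of_apply, hfu, Option.some.injEq, sub_mul,
        ite_mul, one_mul, zero_mul, Finset.sum_sub_distrib, Finset.sum_ite_eq, Finset.mem_univ,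
        if_true, h, sub_self, Pi.zero_apply]

open Classical in
theorem det_parentMatrix [IsDomain R] (f : V → Option V) :
    (parentMatrix R f).det = if IsForest f then 1 else 0 := by
  split_ifs with h
  · exact det_parentMatrix_of_isForest h
  · exact det_parentMatrix_of_not_isForest h

open Classical in
/-- **Matrix-forest theorem**: the determinant of a weighted Laplacian matrix with a sink is the
weighted sum of the forests directed to the sink. -/
theorem det_laplacian_eq_sum_forests [IsDomain R] (w : V → Option V → R) :
    (of fun u v => (if u = v then ∑ o, w u o else 0) - w u (some v)).det =
      ∑ f : V → Option V with IsForest f, ∏ u, w u (f u) := by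
  -- Each row is a weighted sum over the possible parents, so multilinearity expands the determinant
  -- over all parent maps.
  have hrow : (of fun u v => (if u = v then ∑ o, w u o else 0) - w u (some v)) =
      fun u => ∑ o, w u o • (Pi.single u 1 - optionSingle R o : V → R) := by
    ext u v
    simp [Finset.sum_apply, optionSingle_apply, mul_sub, Finset.sum_sub_distrib, Pi.single_apply,
      eq_comm]
  have hM : ∀ f : V → Option V, (fun u => (Pi.single u 1 - optionSingle R (f u) : V → R)) =
      parentMatrix R f := by
    intro f
    ext u v
    simp [parentMatrix, optionSingle_apply, Pi.single_apply, eq_comm]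
  rw [hrow]
  change detRowAlternating.toMultilinearMap _ = _
  rw [MultilinearMap.map_sum, Finset.sum_filter]
  refine Finset.sum_congr rfl fun f _ => ?_
  rw [MultilinearMap.map_smul_univ]
  change _ • det (fun u => (Pi.single u 1 - optionSingle R (f u) : V → R)) = _
  rw [hM, det_parentMatrix]
  simp

end MatrixForest

/-! ### Determinant of a blown-up matrix -/

section BlowUp

variable {ι R : Type*} [DecidableEq ι] [CommRing R]

/-- The matrix `diag δ - a`, blown up so that `i` is replaced by the points of `κ i`. -/
def blowUpMatrix (κ : ι → Type*) [∀ i, DecidableEq (κ i)] (δ : ι → R) (a : ι → ι → R) :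
    Matrix (Σ i, κ i) (Σ i, κ i) R :=
  of fun u v => (if u = v then δ u.1 else 0) - a u.1 v.1

/-- The matrix `diag δ - a`, whose columns are weighted by the cardinalities of the `κ i`. -/
def collapsedMatrix (κ : ι → Type*) [∀ i, Fintype (κ i)] (δ : ι → R) (a : ι → ι → R) :
    Matrix ι ι R :=
  of fun i j => (if i = j then δ i else 0) - a i j * Fintype.card (κ j)

variable {κ : ι → Type*}

theorem mapMatrix_blowUpMatrix [Fintype ι] [∀ i, Fintype (κ i)] [∀ i, DecidableEq (κ i)]
    {S : Type*} [CommRing S] (φ : R →+* S) (δ : ι → R) (a : ι → ι → R) :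
    φ.mapMatrix (blowUpMatrix κ δ a) =
      blowUpMatrix κ (fun i => φ (δ i)) fun i j => φ (a i j) := by
  ext u v
  simp only [blowUpMatrix, RingHom.mapMatrix_apply, map_apply, of_apply, map_sub, apply_ite φ,
    map_zero]

theorem mapMatrix_collapsedMatrix [Fintype ι] [∀ i, Fintype (κ i)]
    {S : Type*} [CommRing S] (φ : R →+* S) (δ : ι → R) (a : ι → ι → R) :
    φ.mapMatrix (collapsedMatrix κ δ a) =
      collapsedMatrix κ (fun i => φ (δ i)) fun i j => φ (a i j) := by
  ext i j
  simp only [collapsedMatrix, RingHom.mapMatrix_apply, map_apply, of_apply, map_sub, apply_ite φ,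
    map_zero, map_mul, map_natCast]

variable [Fintype ι] [∀ i, Fintype (κ i)] [∀ i, DecidableEq (κ i)] [∀ i, Nonempty (κ i)]

theorem det_blowUpMatrix_of_ne_zero {K : Type*} [Field K] (δ : ι → K) (hδ : ∀ i, δ i ≠ 0)
    (a : ι → ι → K) :
    (blowUpMatrix κ δ a).det =
      (∏ i, δ i ^ (Fintype.card (κ i) - 1)) * (collapsedMatrix κ δ a).det := by
  let P : Matrix (Σ i, κ i) ι K := of fun u j => if u.1 = j then (δ u.1)⁻¹ else 0
  let Q : Matrix ι (Σ i, κ i) K := of fun i v => a i v.1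
  have h1 : blowUpMatrix κ δ a = diagonal (fun u : Σ i, κ i => δ u.1) * (1 - P * Q) := by
    ext u v
    rw [diagonal_mul, Matrix.sub_apply, mul_sub, Matrix.mul_apply, Matrix.one_apply]
    simp [P, Q, blowUpMatrix, hδ]
  have h2 : collapsedMatrix κ δ a = (1 - Q * P) * diagonal δ := by
    ext i j
    have h : ∀ k, (∑ _x : κ k, a i k * if k = j then (δ k)⁻¹ else 0) =
        if k = j then Fintype.card (κ j) * (a i j * (δ j)⁻¹) else 0 := by
      intro k
      split_ifs with h
      · subst h; simp
      · simp
    rw [mul_diagonal, Matrix.sub_apply, sub_mul, Matrix.mul_apply, Matrix.one_apply]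
    simp only [P, Q, collapsedMatrix, of_apply, Fintype.sum_sigma, h, Finset.sum_ite_eq',
      Finset.mem_univ, if_true, ite_mul, one_mul, zero_mul]
    congr 1
    · split_ifs with h
      · rw [h]
      · rfl
    · have := hδ j
      field_simp
  rw [h1, h2, det_mul, det_mul, det_diagonal, det_diagonal, det_one_sub_mul_comm P Q,
    Fintype.prod_sigma]
  have h3 : ∀ i, ∏ _k : κ i, δ i = δ i ^ (Fintype.card (κ i) - 1) * δ i := fun i => by
    rw [Finset.prod_const, Finset.card_univ, ← pow_succ, Nat.sub_add_cancel Fintype.card_pos]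
  simp only [h3, Finset.prod_mul_distrib]
  ring

theorem det_blowUpMatrix_of_injective {K : Type*} [Field K] (φ : R →+* K)
    (hφ : Function.Injective φ) (δ : ι → R) (hδ : ∀ i, δ i ≠ 0) (a : ι → ι → R) :
    (blowUpMatrix κ δ a).det =
      (∏ i, δ i ^ (Fintype.card (κ i) - 1)) * (collapsedMatrix κ δ a).det := by
  apply hφ
  simp only [RingHom.map_det, map_mul, map_prod, map_pow, mapMatrix_blowUpMatrix,
    mapMatrix_collapsedMatrix]
  exact det_blowUpMatrix_of_ne_zero _ (fun i => (map_ne_zero_iff φ hφ).2 (hδ i)) _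

/-- Zero entries of `δ` are allowed: replace `δ i` by `X + δ i`, which is nonzero in the fraction
field of `R[X]`, then evaluate at `X = 0`. -/
theorem det_blowUpMatrix [IsDomain R] (δ : ι → R) (a : ι → ι → R) :
    (blowUpMatrix κ δ a).det =
      (∏ i, δ i ^ (Fintype.card (κ i) - 1)) * (collapsedMatrix κ δ a).det := by
  have h := congrArg (evalRingHom (0 : R)) <|
    det_blowUpMatrix_of_injective (κ := κ) (algebraMap R[X] (FractionRing R[X]))
      (IsFractionRing.injective _ _) (fun i => X + C (δ i)) (fun i => X_add_C_ne_zero _)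
      (fun i j => C (a i j))
  simpa only [RingHom.map_det, map_mul, map_prod, map_pow, mapMatrix_blowUpMatrix,
    mapMatrix_collapsedMatrix, coe_evalRingHom, eval_add, eval_X, eval_C, zero_add] using h

end BlowUp
end MultitypeCayley
namespace MultitypeCayley
-- Rooted trees and their parent maps
namespace RootedTree

variable {V : Type*}

theorem exists_arc (T : RootedTree V) {u : V} (hu : u ≠ T.root) : ∃ v, T.Arc u v := by
  obtain ⟨p, hp⟩ := T.isTree.connected.exists_walk_length_eq_dist u T.root
  cases p with
  | nil => exact absurd rfl hu
  | cons h q =>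
    refine ⟨_, h, ?_⟩
    have h1 := SimpleGraph.dist_le q
    have h2 := T.isTree.dist_eq_dist_add_one_of_adj T.root h
    simp only [SimpleGraph.Walk.length_cons] at hp
    rw [SimpleGraph.dist_comm (u := T.root), SimpleGraph.dist_comm (u := T.root)] at h2
    omega

theorem Arc.unique {T : RootedTree V} {u v w : V} (hv : T.Arc u v) (hw : T.Arc u w) : v = w := by
  obtain ⟨p, hp⟩ := T.isTree.connected.exists_walk_length_eq_dist v T.root
  obtain ⟨q, hq⟩ := T.isTree.connected.exists_walk_length_eq_dist w T.root
  have hp' := (SimpleGraph.Walk.cons hv.1 p).isPath_of_length_eq_dist (by simp [hp, hv.2])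
  have hq' := (SimpleGraph.Walk.cons hw.1 q).isPath_of_length_eq_dist (by simp [hq, hw.2])
  have h := (T.isTree.isAcyclic.subsingleton_path _ _).elim ⟨_, hp'⟩ ⟨_, hq'⟩
  simp only [Subtype.mk.injEq, SimpleGraph.Walk.cons.injEq] at h
  exact h.1

theorem not_arc_root (T : RootedTree V) (v : V) : ¬ T.Arc T.root v := by
  rintro ⟨-, h⟩
  simp at h

theorem adj_iff_arc (T : RootedTree V) {u v : V} :
    T.graph.Adj u v ↔ T.Arc u v ∨ T.Arc v u := by
  refine ⟨fun h => ?_, fun h => h.elim (fun h => h.1) fun h => h.1.symm⟩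
  have h2 := T.isTree.dist_eq_dist_add_one_of_adj T.root h
  rw [SimpleGraph.dist_comm (u := T.root), SimpleGraph.dist_comm (u := T.root)] at h2
  exact h2.imp (fun h' => ⟨h, h'⟩) fun h' => ⟨h.symm, h'⟩

open Classical in
/-- The parent of a vertex; the root has none. -/
noncomputable def parent (T : RootedTree V) (u : V) : Option V :=
  if h : ∃ v, T.Arc u v then some h.choose else none

theorem parent_eq_some_iff {T : RootedTree V} {u v : V} : T.parent u = some v ↔ T.Arc u v := by
  unfold parent
  split_ifs with h
  · rw [Option.some.injEq]
    exact ⟨fun e => e ▸ h.choose_spec, fun e => h.choose_spec.unique e⟩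
  · simpa using fun e => h ⟨v, e⟩

theorem parent_eq_none_iff {T : RootedTree V} {u : V} : T.parent u = none ↔ u = T.root := by
  constructor
  · intro h
    by_contra hu
    obtain ⟨v, hv⟩ := T.exists_arc hu
    rw [parent_eq_some_iff.2 hv] at h
    simp at h
  · rintro rfl
    cases h : T.parent T.root with
    | none => rfl
    | some v => exact absurd (parent_eq_some_iff.1 h) (T.not_arc_root v)

theorem parent_injective : Function.Injective (parent : RootedTree V → V → Option V) := by
  intro T T' h
  have hr : T.root = T'.root := by
    rw [← parent_eq_none_iff, ← h, parent_eq_none_iff]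
  refine RootedTree.ext ?_ hr
  ext u v
  simp only [adj_iff_arc, ← parent_eq_some_iff, h]

theorem isForest_parent (T : RootedTree V) : IsForest T.parent := by
  refine Subrelation.wf ?_ (measure fun u => T.graph.dist u T.root).wf
  intro v u h
  have := (parent_eq_some_iff.1 h).2
  change T.graph.dist v T.root < T.graph.dist u T.root
  omega

/-- Every vertex other than the root is the source of exactly one arc. -/
theorem prod_arcs {M : Type*} [CommMonoid M] [Fintype V] (T : RootedTree V) (w : V → Option V → M) :
    ∏ u, w u (T.parent u) = w T.root none * ∏ e ∈ T.arcs, w e.1 (some e.2) := by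
  classical
  rw [← Finset.mul_prod_erase _ _ (Finset.mem_univ T.root), parent_eq_none_iff.2 rfl]
  congr 1
  symm
  refine Finset.prod_bij (fun e _ => e.1) ?_ ?_ ?_ ?_
  · intro e he
    simp only [arcs, Finset.mem_filter, Finset.mem_univ, true_and] at he
    simp only [Finset.mem_erase, Finset.mem_univ, and_true]
    rintro h
    exact T.not_arc_root _ (h ▸ he)
  · rintro ⟨u, v⟩ h ⟨u', v'⟩ h' rfl
    simp only [arcs, Finset.mem_filter, Finset.mem_univ, true_and] at h h'
    rw [h.unique h']
  · intro u hu
    obtain ⟨v, hv⟩ := T.exists_arc (Finset.ne_of_mem_erase hu)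
    exact ⟨(u, v), by simpa [arcs] using hv, rfl⟩
  · rintro ⟨u, v⟩ h
    simp only [arcs, Finset.mem_filter, Finset.mem_univ, true_and] at h
    simp only [parent_eq_some_iff.2 h]

end RootedTree

variable {V : Type*}

/-- The graph in which every vertex is joined to its parent. -/
def parentGraph (f : V → Option V) : SimpleGraph V :=
  SimpleGraph.fromRel fun u v => f u = some v

theorem IsForest.ne {f : V → Option V} (hf : IsForest f) {u v : V} (h : f u = some v) : u ≠ v := by
  rintro rfl
  exact hf.irrefl.irrefl u h

theorem IsForest.not_some_of_some {f : V → Option V} (hf : IsForest f) {u v : V}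
    (h : f u = some v) : f v ≠ some u :=
  fun h' => hf.asymm.asymm _ _ h h'

theorem isTree_parentGraph [Finite V] {f : V → Option V} (hf : IsForest f) {r : V}
    (hr : ∀ u, f u = none ↔ u = r) : (parentGraph f).IsTree := by
  classical
  have := Fintype.ofFinite V
  have hreach : ∀ u, (parentGraph f).Reachable u r := by
    intro u
    induction u using hf.induction with
    | _ u ih =>
      cases h : f u with
      | none => rw [(hr u).1 h]
      | some v =>
        exact (SimpleGraph.Adj.reachable (by simp [parentGraph, h, hf.ne h])).trans (ih v h)
  have hconn : (parentGraph f).Connected :=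
    { preconnected := fun u v => (hreach u).trans (hreach v).symm
      nonempty := ⟨r⟩ }
  rw [SimpleGraph.isTree_iff_connected_and_card]
  refine ⟨hconn, le_antisymm ?_ hconn.card_vert_le_card_edgeSet_add_one⟩
  -- Every edge joins some `u ≠ r` to its parent, so there are at most `|V| - 1` edges. The default
  -- of `getD` would matter only at `r`, which is erased.
  have hsub : (parentGraph f).edgeSet ⊆
      ((Finset.univ.erase r).image fun u => s(u, (f u).getD u) : Finset (Sym2 V)) := by
    intro e
    induction e with
    | _ u v =>
      simp only [parentGraph, SimpleGraph.mem_edgeSet, SimpleGraph.fromRel_adj, Finset.coe_image,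
        Set.mem_image, Finset.mem_coe, Finset.mem_erase, Finset.mem_univ, and_true]
      rintro ⟨-, h | h⟩
      · exact ⟨u, by rw [Ne, ← hr, h]; simp, by simp [h]⟩
      · exact ⟨v, by rw [Ne, ← hr, h]; simp, by simp [h, Sym2.eq_swap]⟩
  have h1 := Nat.card_mono (Finset.finite_toSet _) hsub
  rw [Nat.card_eq_fintype_card (α := V), ← Finset.card_univ,
    ← Finset.card_erase_add_one (Finset.mem_univ r)]
  refine Nat.add_le_add_right (h1.trans ?_) 1
  rw [Nat.card_eq_card_toFinset, Finset.toFinset_coe]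
  exact Finset.card_image_le

theorem exists_parent_eq [Finite V] {f : V → Option V} (hf : IsForest f) {r : V}
    (hr : ∀ u, f u = none ↔ u = r) : ∃ T : RootedTree V, T.parent = f := by
  let T : RootedTree V := ⟨parentGraph f, isTree_parentGraph hf hr, r⟩
  refine ⟨T, funext fun u => ?_⟩
  induction u using hf.induction with
  | _ u ih =>
    cases h : f u with
    | none => exact RootedTree.parent_eq_none_iff.2 ((hr u).1 h)
    | some v =>
      have hadj : T.graph.Adj u v := by simp [T, parentGraph, h, hf.ne h]
      rw [RootedTree.parent_eq_some_iff]
      -- If the edge pointed from `v` to `u`, the induction hypothesis at `v` would give `f v = some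
      -- u`, a 2-cycle.
      refine (T.adj_iff_arc.1 hadj).resolve_right fun h' => ?_
      rw [← RootedTree.parent_eq_some_iff, ih v h] at h'
      exact hf.not_some_of_some h h'

/-! ### Matrix-tree theorem and the count -/

open Polynomial

/-- The weight on arcs `a` and roots `b`, with a variable marking the roots. -/
noncomputable def markedWeight {R : Type*} [CommRing R] (a : V → V → R) (b : V → R) (u : V) :
    Option V → R[X]
  | none => C (b u) * X
  | some v => C (a u v)

/-- The Laplacian matrix of the weight `a` with killing rate `b`, with a variable marking the
killing. -/
noncomputable def markedLaplacian {R : Type*} [CommRing R] [Fintype V] [DecidableEq V]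
    (a : V → V → R) (b : V → R) : Matrix V V R[X] :=
  Matrix.of fun u v => (if u = v then C (b u) * X + ∑ v, C (a u v) else 0) - C (a u v)

variable {R : Type*} [CommRing R] [Fintype V]

theorem prod_markedWeight (a : V → V → R) (b : V → R) (f : V → Option V) :
    ∏ u, markedWeight a b u (f u) =
      C (∏ u, (f u).elim (b u) (a u)) * X ^ (Finset.univ.filter fun u => f u = none).card := by
  have h : ∀ u, markedWeight a b u (f u) =
      C ((f u).elim (b u) (a u)) * if f u = none then X else 1 := by
    intro u
    cases f u <;> simp [markedWeight]
  simp only [h, Finset.prod_mul_distrib, map_prod, ← Finset.prod_filter, Finset.prod_const]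

variable [DecidableEq V] [IsDomain R]

open Classical in
theorem det_markedLaplacian (a : V → V → R) (b : V → R) :
    (markedLaplacian a b).det =
      ∑ f : V → Option V with IsForest f, C (∏ u, (f u).elim (b u) (a u)) *
        X ^ (Finset.univ.filter fun u => f u = none).card := by
  simp only [← prod_markedWeight]
  rw [← det_laplacian_eq_sum_forests]
  simp only [Fintype.sum_option, markedLaplacian, markedWeight]

/-- A forest on a nonempty set has a root, so every term is divisible by `X`. -/
theorem coeff_zero_det_markedLaplacian [Nonempty V] (a : V → V → R) (b : V → R) :
    (markedLaplacian a b).det.coeff 0 = 0 := by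
  classical
  rw [det_markedLaplacian, finsetSum_coeff]
  refine Finset.sum_eq_zero fun f hf => ?_
  obtain ⟨u, -, hu⟩ := (Finset.mem_filter.1 hf).2.has_min Set.univ Set.univ_nonempty
  have h : f u = none := by
    cases h : f u with
    | none => rfl
    | some v => exact absurd h (hu v trivial)
  have hc : (Finset.univ.filter fun u => f u = none).card ≠ 0 :=
    Finset.card_ne_zero_of_mem (a := u) (by simp [h])
  rw [coeff_C_mul, coeff_X_pow, if_neg hc.symm, mul_zero]

/-- **Matrix-tree theorem** for rooted trees oriented toward the root. -/
theorem coeff_one_det_markedLaplacian (a : V → V → R) (b : V → R) :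
    (markedLaplacian a b).det.coeff 1 =
      ∑ T : RootedTree V, b T.root * ∏ e ∈ T.arcs, a e.1 e.2 := by
  classical
  rw [det_markedLaplacian, finsetSum_coeff]
  simp only [coeff_C_mul, coeff_X_pow, mul_ite, mul_one, mul_zero, ← Finset.sum_filter,
    Finset.filter_filter]
  symm
  refine Finset.sum_bij (fun T _ => T.parent) ?_ ?_ ?_ ?_
  · intro T _
    simp [T.isForest_parent, RootedTree.parent_eq_none_iff, Finset.filter_eq']
  · exact fun T _ T' _ h => RootedTree.parent_injective h
  · intro f hf
    obtain ⟨-, hf, hc⟩ := Finset.mem_filter.1 hf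
    obtain ⟨r, hr⟩ := Finset.card_eq_one.1 hc.symm
    obtain ⟨T, hT⟩ := exists_parent_eq hf (r := r) fun u => by
      simpa using Finset.ext_iff.1 hr u
    exact ⟨T, Finset.mem_univ _, hT⟩
  · intro T _
    exact (T.prod_arcs fun u o => o.elim (b u) (a u)).symm

/-- The number of multitype Cayley trees with prescribed edge types. -/
theorem card_embeddedTrees {d : ℕ} (n : Fin d → ℕ) (hn : ∀ t, 0 < n t) (ρ : Fin d)
    (D : Finset (Fin d × Fin d)) :
    (embeddedTrees n ρ D).card =
      (∏ s : Fin d, (∑ t : Fin d with (s, t) ∈ D, n t) ^ (n s - 1)) *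
        ∑ A ∈ cayleyTrees ρ with A.arcs ⊆ D, ∏ e ∈ A.arcs, n e.2 := by
  classical
  have : ∀ t, Nonempty (Fin (n t)) := fun t => ⟨⟨0, hn t⟩⟩
  have : Nonempty (Fin d) := ⟨ρ⟩
  let α : Fin d → Fin d → ℤ := fun s t => if (s, t) ∈ D then 1 else 0
  let β : Fin d → ℤ := fun s => if s = ρ then 1 else 0
  -- Shared by both Laplacians: the weights out of a vertex of type `s` sum to the same value in
  -- each. Loops are included here and cancel on the diagonal.
  let δ : Fin d → ℤ[X] := fun s => C (β s) * X + ∑ t, C (α s t * n t)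
  have hbig : (markedLaplacian (fun u v : Vertex n => α u.1 v.1) fun u => β u.1).det =
      (∏ s, δ s ^ (n s - 1)) * (markedLaplacian (fun s t => α s t * n t) β).det := by
    have h := det_blowUpMatrix (κ := fun t => Fin (n t)) δ fun s t => C (α s t)
    simp only [Fintype.card_fin] at h
    convert h using 3
    · ext1 u v
      simp [markedLaplacian, blowUpMatrix, δ, Fintype.sum_sigma, mul_comm]
    · ext1 s t
      simp [markedLaplacian, collapsedMatrix, δ]
  -- In the coefficient of `X` of the product, the term with the constant coefficient of the small
  -- determinant vanishes.
  have h1 := congrArg (fun p => coeff p 1) hbig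
  simp only [mul_coeff_one, coeff_zero_det_markedLaplacian, coeff_one_det_markedLaplacian,
    mul_zero, add_zero] at h1
  have h0 : (∏ s, δ s ^ (n s - 1)).coeff 0 =
      ∏ s : Fin d, (∑ t : Fin d with (s, t) ∈ D, (n t : ℤ)) ^ (n s - 1) := by
    simp [coeff_zero_eq_eval_zero, eval_prod, eval_finsetSum, δ, α, Finset.sum_filter,
      apply_ite (eval (0 : ℤ))]
  have hL : ∑ T : RootedTree (Vertex n), β T.root.1 * ∏ e ∈ T.arcs, α e.1.1 e.2.1 =
      (embeddedTrees n ρ D).card := by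
    simp [embeddedTrees, multitypeTrees, IsEmbedded, Finset.filter_filter, α, β,
      Finset.prod_ite_zero, Finset.card_filter, ite_and]
    exact Finset.sum_congr rfl fun T _ => by split_ifs <;> rfl
  have hR : ∑ A : RootedTree (Fin d), β A.root * ∏ e ∈ A.arcs, α e.1 e.2 * (n e.2 : ℤ) =
      ∑ A ∈ cayleyTrees ρ with A.arcs ⊆ D, ∏ e ∈ A.arcs, (n e.2 : ℤ) := by
    rw [cayleyTrees, Finset.filter_filter, Finset.sum_filter]
    refine Finset.sum_congr rfl fun A _ => ?_
    simp [α, β, Finset.prod_ite_zero, Finset.subset_iff, ite_and]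
    split_ifs <;> rfl
  rw [hL, h0, hR] at h1
  exact_mod_cast h1

end MultitypeCayley

theorem mainTheorem11 {d : ℕ} (n : Fin d → ℕ) (hn : ∀ t, 0 < n t) (ρ : Fin d)
    (D : Finset (Fin d × Fin d)) :
    (MultitypeCayley.embeddedTrees n ρ D).card =
      (∏ s : Fin d, (∑ t : Fin d with (s, t) ∈ D, n t) ^ (n s - 1)) *
        ∑ A ∈ MultitypeCayley.cayleyTrees ρ with A.arcs ⊆ D, ∏ e ∈ A.arcs, n e.2 := MultitypeCayley.card_embeddedTrees n hn ρ D
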